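/- Let $G$ be a finite group and let $O=C_1\sqcup\dots\sqcup C_m$ be a disjoint union of conjugacy classes of $G$ such that, for every $i$, the elements of $C_i$ generate $G$. Let $S(G,O)$ be the (unital) semigroup generated by the letters $x_g$, $g\in O$, subject to the relations $$x_{g_1}\cdot x_{g_2}=x_{g_2}\cdot x_{g_2^{-1}g_1g_2}=x_{g_1g_2g_1^{-1}}\cdot x_{g_1},\qquad g_1,g_2\in O.$$ For $s=x_{g_1}\cdots x_{g_n}\in S(G,O)$ put $\alpha(s)=g_1\cdots g_n\in G$, let $G_s$ be the subgroup of $G$ generated by $g_1,\dots,g_n$, and let $\tau(s)=(\tau_1(s),\dots,\tau_m(s))$, where $\tau_i(s)$ is the number of indices $j$ with $g_j\in C_i$; these do not depend on the chosen presentation of $s$. Let $S(G,O)^G_{\mathbf 1}=\{s\in S(G,O)\mid G_s=G,\ \alpha(s)=\mathbf 1\}$, and for $\overline k=(k_1,\dots,k_m)\in\mathbb Z_{\ge 0}^m$ let $h_{\overline k}$ be the (finite) number of $s\in S(G,O)^G_{\mathbf 1}$ with $\tau(s)=\overline k$. Then the power series $$\chi_{(G,O)}(t_1,\dots,t_m)=\sum_{\overline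 k\in\mathbb Z_{\ge 0}^m}h_{\overline k}\,t_1^{k_1}\cdots t_m^{k_m}$$ is a rational function, that is, there are polynomials $P,Q\in\mathbb Q[t_1,\dots,t_m]$ with $Q(0)\neq 0$ and $Q\cdot\chi_{(G,O)}=P$ in $\mathbb Q[[t_1,\dots,t_m]]$. -/

import Mathlib

noncomputable section

namespace Factorization

variable {G : Type*} [Group G]

/-- The defining relations of the factorization semigroup `S(G, O)`:
`x_a x_b = x_b x_{b⁻¹ a b}` and `x_a x_b = x_{a b a⁻¹} x_a` for `a, b ∈ O`
(the conjugate is again in `O` when `O` is invariant under conjugation). -/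
inductive Rel (O : Set G) : FreeMonoid O → FreeMonoid O → Prop
  | right (a b c : O) (h : (c : G) = (b : G)⁻¹ * a * b) :
      Rel O (FreeMonoid.of a * FreeMonoid.of b) (FreeMonoid.of b * FreeMonoid.of c)
  | left (a b c : O) (h : (c : G) = (a : G) * b * (a : G)⁻¹) :
      Rel O (FreeMonoid.of a * FreeMonoid.of b) (FreeMonoid.of c * FreeMonoid.of a)

/-- The (unital) factorization semigroup `S(G, O)` with factors in `O`. -/
abbrev FactSemigroup (O : Set G) : Type _ := PresentedMonoid (Rel O)

/-- The product homomorphism `α : S(G, O) → G`, `x_g ↦ g`. -/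
def prodHom (O : Set G) : FactSemigroup O →* G :=
  PresentedMonoid.lift (fun g : O => (g : G)) (by
    rintro _ _ (⟨a, b, c, h⟩ | ⟨a, b, c, h⟩) <;> simp [h, mul_assoc])

open Classical in
/-- `1` if `g` lies in the conjugacy class `c`, and `0` otherwise. -/
def classIndicator (c : ConjClasses G) (g : G) : ℕ := if g ∈ c.carrier then 1 else 0

theorem classIndicator_conj (c : ConjClasses G) (g h : G) :
    classIndicator c (h * g * h⁻¹) = classIndicator c g := by
  have e : ConjClasses.mk (h * g * h⁻¹) = ConjClasses.mk g :=
    (ConjClasses.mk_eq_mk_iff_isConj.2 (isConj_iff.2 ⟨h, rfl⟩)).symm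
  have hm : h * g * h⁻¹ ∈ c.carrier ↔ g ∈ c.carrier := by
    rw [ConjClasses.mem_carrier_iff_mk_eq, ConjClasses.mem_carrier_iff_mk_eq, e]
  unfold classIndicator
  by_cases hg : g ∈ c.carrier
  · rw [if_pos hg, if_pos (hm.2 hg)]
  · rw [if_neg hg, if_neg (fun h' => hg (hm.1 h'))]

/-- The number of factors of an element of `S(G, O)` lying in the conjugacy class `c`,
as a homomorphism of semigroups: `x_g ↦ 1` if `g ∈ c` and `x_g ↦ 0` otherwise. -/
def classCount (O : Set G) (c : ConjClasses G) : FactSemigroup O →* Multiplicative ℕ :=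
  PresentedMonoid.lift (fun g : O => Multiplicative.ofAdd (classIndicator c (g : G))) (by
    rintro _ _ (⟨a, b, d, h⟩ | ⟨a, b, d, h⟩)
    · have hd : classIndicator c (d : G) = classIndicator c (a : G) := by
        rw [h, ← classIndicator_conj c (a : G) (b : G)⁻¹, inv_inv]
      simp only [map_mul, FreeMonoid.lift_eval_of, hd]
      exact mul_comm (Multiplicative.ofAdd _) _
    · have hd : classIndicator c (d : G) = classIndicator c (b : G) := by
        rw [h, classIndicator_conj]
      simp only [map_mul, FreeMonoid.lift_eval_of, hd]
      exact mul_comm (Multiplicative.ofAdd _) _)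

/-- The subgroup generated by the letters of a word in the alphabet `O`. -/
def wordSubgroup (O : Set G) (w : FreeMonoid O) : Subgroup G :=
  Subgroup.closure {g | ∃ a ∈ FreeMonoid.toList w, (a : G) = g}

theorem wordSubgroup_of (O : Set G) (a : O) :
    wordSubgroup O (FreeMonoid.of a) = Subgroup.closure {(a : G)} := by
  unfold wordSubgroup
  congr 1
  ext g
  simp [FreeMonoid.toList_of, eq_comm]

theorem wordSubgroup_mul (O : Set G) (v w : FreeMonoid O) :
    wordSubgroup O (v * w) = wordSubgroup O v ⊔ wordSubgroup O w := by
  unfold wordSubgroup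
  rw [← Subgroup.closure_union]
  congr 1
  ext g
  simp only [FreeMonoid.toList_mul, List.mem_append, Set.mem_ofPred_eq, Set.mem_union]
  constructor
  · rintro ⟨a, ha | ha, rfl⟩
    · exact Or.inl ⟨a, ha, rfl⟩
    · exact Or.inr ⟨a, ha, rfl⟩
  · rintro (⟨a, ha, rfl⟩ | ⟨a, ha, rfl⟩)
    · exact ⟨a, Or.inl ha, rfl⟩
    · exact ⟨a, Or.inr ha, rfl⟩

/-- Two words that represent the same element of `S(G, O)` generate the same subgroup. -/
theorem wordSubgroup_eq (O : Set G) {v w : FreeMonoid O} (h : conGen (Rel O) v w) :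
    wordSubgroup O v = wordSubgroup O w := by
  let r : Con (FreeMonoid O) :=
    { r := fun v w => wordSubgroup O v = wordSubgroup O w
      iseqv := ⟨fun _ => rfl, fun h => h.symm, fun h h' => h.trans h'⟩
      mul' := fun {a b c d} h h' => by
        rw [wordSubgroup_mul, wordSubgroup_mul, h, h'] }
  have key : conGen (Rel O) ≤ r := by
    refine Con.conGen_le.2 ?_
    rintro _ _ (⟨a, b, c, h⟩ | ⟨a, b, c, h⟩)
    all_goals
      change wordSubgroup O _ = wordSubgroup O _
      simp only [wordSubgroup_mul, wordSubgroup_of]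
      have ha : (a : G) ∈ Subgroup.closure {(a : G)} := Subgroup.subset_closure rfl
      have hb : (b : G) ∈ Subgroup.closure {(b : G)} := Subgroup.subset_closure rfl
      have hc : (c : G) ∈ Subgroup.closure {(c : G)} := Subgroup.subset_closure rfl
      apply le_antisymm <;> refine sup_le ?_ ?_ <;>
        rw [Subgroup.closure_le, Set.singleton_subset_iff, SetLike.mem_coe]
    · have e : (a : G) = b * c * (b : G)⁻¹ := by rw [h]; group
      rw [e]
      exact mul_mem (mul_mem (Subgroup.mem_sup_left hb) (Subgroup.mem_sup_right hc))
        (inv_mem (Subgroup.mem_sup_left hb))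
    · exact Subgroup.mem_sup_left hb
    · exact Subgroup.mem_sup_right hb
    · rw [h]
      exact mul_mem (mul_mem (inv_mem (Subgroup.mem_sup_right hb)) (Subgroup.mem_sup_left ha))
        (Subgroup.mem_sup_right hb)
    · exact Subgroup.mem_sup_right ha
    · have e : (b : G) = (a : G)⁻¹ * c * a := by rw [h]; group
      rw [e]
      exact mul_mem (mul_mem (inv_mem (Subgroup.mem_sup_right ha)) (Subgroup.mem_sup_left hc))
        (Subgroup.mem_sup_right ha)
    · rw [h]
      exact mul_mem (mul_mem (Subgroup.mem_sup_left ha) (Subgroup.mem_sup_right hb))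
        (inv_mem (Subgroup.mem_sup_left ha))
    · exact Subgroup.mem_sup_left ha
  exact key h

/-- The subgroup `G_s` of `G` generated by the factors `g₁, …, gₙ` of
`s = x_{g₁} ⋯ x_{gₙ} ∈ S(G, O)`. -/
def factorSubgroup (O : Set G) (s : FactSemigroup O) : Subgroup G :=
  Quotient.lift (wordSubgroup O) (fun _ _ h => wordSubgroup_eq O h) s

theorem factorSubgroup_mk (O : Set G) (w : FreeMonoid O) :
    factorSubgroup O (PresentedMonoid.mk (Rel O) w) = wordSubgroup O w := rfl

/-- `S(G, O)^H_Z`: the elements `s` of `S(G, O)` with `G_s = H` and `α(s) ∈ Z`. -/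
def factSet (O : Set G) (H Z : Subgroup G) : Set (FactSemigroup O) :=
  {s | factorSubgroup O s = H ∧ prodHom O s ∈ Z}

/-- The union `O = C₁ ∪ … ∪ C_m` of the given conjugacy classes. -/
def classUnion {m : ℕ} (C : Fin m → ConjClasses G) : Set G := ⋃ i, (C i).carrier

/-- The type `τ(s) = (τ₁(s), …, τ_m(s))`, where `τᵢ(s)` is the number of factors of `s`
in `Cᵢ`. -/
def typeVector {m : ℕ} (C : Fin m → ConjClasses G) (s : FactSemigroup (classUnion C)) :
    Fin m →₀ ℕ :=
  Finsupp.equivFunOnFinite.symm fun i => (classCount (classUnion C) (C i) s).toAdd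

/-- The elements `s` of `S(G, O)^G_1` of type `k`. -/
def typeFiber {m : ℕ} (C : Fin m → ConjClasses G) (k : Fin m →₀ ℕ) :
    Set (FactSemigroup (classUnion C)) :=
  {s | s ∈ factSet (classUnion C) ⊤ ⊥ ∧ typeVector C s = k}

theorem length_le_sum_classCount {m : ℕ} (C : Fin m → ConjClasses G)
    (w : FreeMonoid (classUnion C)) :
    (FreeMonoid.toList w).length ≤ ∑ i,
      (classCount (classUnion C) (C i) (PresentedMonoid.mk (Rel (classUnion C)) w)).toAdd := by
  induction w using FreeMonoid.inductionOn' with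
  | one => simp
  | of_mul a w ih =>
    obtain ⟨j, hj⟩ := Set.mem_iUnion.1 a.2
    have h1 : 1 ≤ ∑ i, (classCount (classUnion C) (C i)
        (PresentedMonoid.mk (Rel (classUnion C)) (FreeMonoid.of a))).toAdd := by
      refine le_trans ?_ (Finset.single_le_sum (fun _ _ => Nat.zero_le _) (Finset.mem_univ j))
      change 1 ≤ (classCount (classUnion C) (C j)
        (PresentedMonoid.of (Rel (classUnion C)) a)).toAdd
      rw [classCount, PresentedMonoid.lift_of, toAdd_ofAdd, classIndicator, if_pos hj]
    simp only [map_mul, toAdd_mul, Finset.sum_add_distrib, FreeMonoid.toList_mul,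
      FreeMonoid.toList_of, List.length_append, List.length_singleton]
    exact add_le_add h1 ih

/-- For a finite group there are only finitely many elements of each type, so that the
cardinalities below are genuine. -/
theorem typeFiber_finite [Finite G] {m : ℕ} (C : Fin m → ConjClasses G) (k : Fin m →₀ ℕ) :
    (typeFiber C k).Finite := by
  refine ((List.finite_length_le (classUnion C) (∑ i, k i)).image
    (fun l => PresentedMonoid.mk (Rel (classUnion C)) (FreeMonoid.ofList l))).subset ?_
  rintro s ⟨-, hs⟩
  obtain ⟨w, rfl⟩ := PresentedMonoid.surjective_mk s
  refine ⟨FreeMonoid.toList w, ?_, rfl⟩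
  rw [← hs]
  exact length_le_sum_classCount C w

/-- The generating function `χ_{(G, O)}(t₁, …, t_m) = ∑_k h_k t^k`, where `h_k` is the number
of elements of `S(G, O)^G_1` of type `k`. -/
def genFun {m : ℕ} (C : Fin m → ConjClasses G) : MvPowerSeries (Fin m) ℚ :=
  fun k => ((typeFiber C k).ncard : ℚ)

/-- A formal power series is a rational function if it is the expansion at the origin of a
quotient `P / Q` of polynomials, where `Q` does not vanish at the origin. -/
def IsRationalFunction {m : ℕ} (f : MvPowerSeries (Fin m) ℚ) : Prop :=
  ∃ P Q : MvPolynomial (Fin m) ℚ, MvPolynomial.coeff 0 Q ≠ 0 ∧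
    (Q : MvPowerSeries (Fin m) ℚ) * f = (P : MvPowerSeries (Fin m) ℚ)

end Factorization

end

/-! For a ∈ O, moving `x_a ^ |G|` past a letter conjugates that letter by a^|G| = 1. So `x_a ^ |G|`
is central in S(G, O), and `prodHom` sends it to 1. Multiplication by these elements makes S(G, O)
an ℕ^O-set graded by type, and S(G, O)^G_1 is stable under it. A word longer than |O|·|G| repeats
some letter a at least |G| times, and these copies can be gathered in front as `x_a ^ |G|`; hence
finitely many short words generate the ℕ^O-set (`exists_centralProd_mul_ofList`).

Rationality then follows from a set-theoretic Hilbert–Serre theorem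
(`hasDenominator_of_subset_orbits`). A stable subset of a single orbit is parametrized by a
difference of two upper sets of ℕ^O. By Dickson's lemma an upper set is a finite union of translated
orthants, and inclusion–exclusion reduces its series to geometric ones. The common denominator is
the product over a ∈ O of 1 - t^(|G|·τ(x_a)). -/

/-- The generating series of a set `Y` with respect to a weight `τ`: the coefficient at `k`
is the number of elements of `Y` of weight `k`. -/
noncomputable def weightSeries {X ι : Type*} (τ : X → ι →₀ ℕ) (Y : Set X) : MvPowerSeries ι ℚ :=
  fun k => ((Y ∩ τ ⁻¹' {k}).ncard : ℚ)

/-! ### Counting series of graded sets -/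

section WeightSeries

variable {X X' ι : Type*}

theorem coeff_weightSeries (τ : X → ι →₀ ℕ) (Y : Set X) (k : ι →₀ ℕ) :
    MvPowerSeries.coeff k (weightSeries τ Y) = ((Y ∩ τ ⁻¹' {k}).ncard : ℚ) := rfl

theorem weightSeries_empty (τ : X → ι →₀ ℕ) : weightSeries τ ∅ = 0 := by
  ext k
  simp [coeff_weightSeries]

theorem weightSeries_union_add_inter {τ : X → ι →₀ ℕ} (hτ : ∀ k, (τ ⁻¹' {k}).Finite)
    (Y Z : Set X) :
    weightSeries τ (Y ∪ Z) + weightSeries τ (Y ∩ Z) = weightSeries τ Y + weightSeries τ Z := by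
  ext k
  simp only [map_add, coeff_weightSeries]
  have h := Set.ncard_union_add_ncard_inter (Y ∩ τ ⁻¹' {k}) (Z ∩ τ ⁻¹' {k})
    ((hτ k).inter_of_right _) ((hτ k).inter_of_right _)
  rw [← Set.union_inter_distrib_right, ← Set.inter_inter_distrib_right] at h
  exact_mod_cast h

theorem weightSeries_sdiff {τ : X → ι →₀ ℕ} (hτ : ∀ k, (τ ⁻¹' {k}).Finite) (Y Z : Set X) :
    weightSeries τ (Y \ Z) = weightSeries τ Y - weightSeries τ (Y ∩ Z) := by
  have h := weightSeries_union_add_inter hτ (Y \ Z) (Y ∩ Z)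
  have e : Y \ Z ∩ (Y ∩ Z) = ∅ := by
    ext x
    simp only [Set.mem_inter_iff, Set.mem_sdiff, Set.mem_empty_iff_false]
    tauto
  rw [Set.sdiff_union_inter, e, weightSeries_empty, add_zero] at h
  rw [h, add_sub_cancel_right]

theorem weightSeries_image {τ : X → ι →₀ ℕ} {τ' : X' → ι →₀ ℕ} {f : X → X'} {Y : Set X}
    (hf : Set.InjOn f Y) {c : ι →₀ ℕ} (h : ∀ x, τ' (f x) = c + τ x) :
    weightSeries τ' (f '' Y) = MvPowerSeries.monomial c 1 * weightSeries τ Y := by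
  classical
  ext k
  rw [MvPowerSeries.coeff_monomial_mul]
  split_ifs with hk
  · rw [one_mul, coeff_weightSeries, coeff_weightSeries,
      ← (hf.mono Set.inter_subset_left).ncard_image]
    congr 2
    ext y
    simp only [Set.mem_inter_iff, Set.mem_image, Set.mem_preimage, Set.mem_singleton_iff]
    constructor
    · rintro ⟨⟨x, hx, rfl⟩, e⟩
      exact ⟨x, ⟨hx, by rw [← e, h, add_tsub_cancel_left]⟩, rfl⟩
    · rintro ⟨x, ⟨hx, e⟩, rfl⟩
      exact ⟨⟨x, hx, rfl⟩, by rw [h, e, add_tsub_cancel_of_le hk]⟩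
  · rw [coeff_weightSeries, Nat.cast_eq_zero]
    convert! Set.ncard_empty X'
    refine Set.eq_empty_of_forall_notMem ?_
    rintro _ ⟨⟨x, hx, rfl⟩, e⟩
    refine hk ?_
    rw [← show τ' (f x) = k from e, h]
    exact le_self_add

end WeightSeries

/-- `f` becomes a polynomial after multiplication by `Q`. -/
def HasDenominator {ι : Type*} (Q : MvPolynomial ι ℚ) (f : MvPowerSeries ι ℚ) : Prop :=
  ∃ P : MvPolynomial ι ℚ, (Q : MvPowerSeries ι ℚ) * f = P

namespace HasDenominator

variable {ι : Type*} {Q : MvPolynomial ι ℚ} {f g : MvPowerSeries ι ℚ}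

theorem zero : HasDenominator Q 0 := ⟨0, by simp⟩

theorem add (hf : HasDenominator Q f) (hg : HasDenominator Q g) : HasDenominator Q (f + g) := by
  obtain ⟨P, hP⟩ := hf
  obtain ⟨R, hR⟩ := hg
  exact ⟨P + R, by rw [mul_add, hP, hR, MvPolynomial.coe_add]⟩

theorem mul_left (R : MvPolynomial ι ℚ) (hf : HasDenominator Q f) :
    HasDenominator Q ((R : MvPowerSeries ι ℚ) * f) := by
  obtain ⟨P, hP⟩ := hf
  exact ⟨R * P, by rw [mul_left_comm, hP, MvPolynomial.coe_mul]⟩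

theorem monomial_mul (c : ι →₀ ℕ) (hf : HasDenominator Q f) :
    HasDenominator Q (MvPowerSeries.monomial c 1 * f) := by
  rw [← MvPolynomial.coe_monomial]
  exact hf.mul_left _

theorem sub (hf : HasDenominator Q f) (hg : HasDenominator Q g) : HasDenominator Q (f - g) := by
  have h := hf.add (hg.mul_left (-1 : MvPolynomial ι ℚ))
  have e : ((-1 : MvPolynomial ι ℚ) : MvPowerSeries ι ℚ) = -1 := by
    rw [eq_neg_iff_add_eq_zero, ← MvPolynomial.coe_one, ← MvPolynomial.coe_add,
      neg_add_cancel, MvPolynomial.coe_zero]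
  rwa [e, neg_one_mul, ← sub_eq_add_neg] at h

end HasDenominator

/-! ### Upper sets in ℕ^σ -/

section Cones

variable {σ ι : Type*} [Fintype σ] (d : (σ →₀ ℕ) →+ (ι →₀ ℕ))

/-- Each `d (single j 1)` has degree at least 1, so every coordinate of `a` is at most the degree of
`d a`. -/
theorem finite_fiber_of_ne_zero (hd : ∀ j, d (Finsupp.single j 1) ≠ 0) (k : ι →₀ ℕ) :
    (d ⁻¹' {k}).Finite := by
  classical
  refine (Set.finite_Iic (Finsupp.equivFunOnFinite.symm fun _ : σ => k.degree)).subset ?_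
  rintro a rfl j
  have h1 : Finsupp.single j (a j) ≤ a := Finsupp.single_le_iff.2 le_rfl
  have h2 : d a = a j • d (Finsupp.single j 1) + d (a - Finsupp.single j (a j)) := by
    rw [← map_nsmul, ← map_add]
    simp [add_tsub_cancel_of_le h1]
  have h3 : (d (Finsupp.single j 1)).degree ≠ 0 := by
    rw [Ne, Finsupp.degree_eq_zero_iff]
    exact hd j
  change a j ≤ (d a).degree
  rw [h2, map_add, map_nsmul, smul_eq_mul]
  exact (Nat.le_mul_of_pos_right _ (Nat.pos_of_ne_zero h3)).trans le_self_add

/-- The common denominator of the generating series of upper sets in `σ →₀ ℕ`. -/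
noncomputable def coneDenominator : MvPolynomial ι ℚ :=
  ∏ j, (1 - MvPolynomial.monomial (d (Finsupp.single j 1)) 1)

variable {d} (hd : ∀ j, d (Finsupp.single j 1) ≠ 0)

include hd

theorem coeff_zero_coneDenominator : MvPolynomial.coeff 0 (coneDenominator d) ≠ 0 := by
  classical
  rw [← MvPolynomial.constantCoeff_eq, coneDenominator, map_prod]
  refine Finset.prod_ne_zero_iff.2 fun j _ => ?_
  rw [map_sub, map_one, MvPolynomial.constantCoeff_eq, MvPolynomial.coeff_monomial, if_neg (hd j),
    sub_zero]
  exact one_ne_zero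

/-- The factor for `j` subtracts the translate by `single j 1`, which leaves exactly the points with
`a j = 0`. -/
theorem prod_mul_weightSeries_univ (J : Finset σ) :
    (∏ j ∈ J, (1 - MvPowerSeries.monomial (d (Finsupp.single j 1)) (1 : ℚ))) *
      weightSeries d Set.univ = weightSeries d {a | ∀ j ∈ J, a j = 0} := by
  classical
  induction J using Finset.induction_on with
  | empty => simp
  | insert j J hj ih =>
    have e : {a : σ →₀ ℕ | ∀ i ∈ insert j J, a i = 0} = {a | ∀ i ∈ J, a i = 0} \
        ((fun a => Finsupp.single j 1 + a) '' {a | ∀ i ∈ J, a i = 0}) := by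
      ext a
      simp only [Finset.forall_mem_insert, Set.mem_ofPred_eq, Set.mem_sdiff, Set.mem_image]
      constructor
      · rintro ⟨h1, h2⟩
        refine ⟨h2, ?_⟩
        rintro ⟨b, -, rfl⟩
        simp at h1
      · rintro ⟨h1, h2⟩
        refine ⟨?_, h1⟩
        by_contra h3
        have h4 : Finsupp.single j 1 ≤ a := Finsupp.single_le_iff.2 (Nat.one_le_iff_ne_zero.2 h3)
        refine h2 ⟨a - Finsupp.single j 1, fun i hi => ?_, add_tsub_cancel_of_le h4⟩
        simp [h1 i hi]
    have e' : {a : σ →₀ ℕ | ∀ i ∈ J, a i = 0} ∩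
        ((fun a => Finsupp.single j 1 + a) '' {a | ∀ i ∈ J, a i = 0}) =
        (fun a => Finsupp.single j 1 + a) '' {a | ∀ i ∈ J, a i = 0} := by
      refine Set.inter_eq_right.2 ?_
      rintro _ ⟨a, ha, rfl⟩ i hi
      have : j ≠ i := fun h => hj (h ▸ hi)
      simp [ha i hi, this]
    rw [Finset.prod_insert hj, mul_assoc, ih, e, weightSeries_sdiff (finite_fiber_of_ne_zero d hd),
      e', weightSeries_image (τ := d) ((add_right_injective _).injOn) (map_add d _), sub_mul,
      one_mul]

theorem hasDenominator_univ : HasDenominator (coneDenominator d) (weightSeries d Set.univ) := by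
  refine ⟨1, ?_⟩
  have e : ((coneDenominator d : MvPolynomial ι ℚ) : MvPowerSeries ι ℚ) =
      ∏ j, (1 - MvPowerSeries.monomial (d (Finsupp.single j 1)) (1 : ℚ)) := by
    rw [coneDenominator, ← MvPolynomial.coeToMvPowerSeries.ringHom_apply, map_prod]
    refine Finset.prod_congr rfl fun j _ => ?_
    rw [map_sub, map_one, MvPolynomial.coeToMvPowerSeries.ringHom_apply, MvPolynomial.coe_monomial]
  rw [e, prod_mul_weightSeries_univ hd]
  -- Only the origin survives. Viewing it as the image of a one-point set of weight 0 gives the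
  -- series 1.
  have e2 : {a : σ →₀ ℕ | ∀ j ∈ Finset.univ, a j = 0} = (fun _ : Unit => 0) '' Set.univ := by
    ext a
    simp [Finsupp.ext_iff, eq_comm]
  rw [e2, weightSeries_image (τ := fun _ : Unit => (0 : ι →₀ ℕ)) (c := 0)
    (fun _ _ _ _ _ => rfl) (by simp)]
  classical
  ext k
  rw [MvPowerSeries.coeff_monomial_mul, if_pos zero_le, coeff_weightSeries,
    MvPolynomial.coe_one, MvPowerSeries.coeff_one]
  split_ifs with h
  · simp [h]
  · have : (fun _ : Unit => (0 : ι →₀ ℕ)) ⁻¹' {k} = ∅ := by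
      ext; simpa using Ne.symm h
    simp [this]

theorem hasDenominator_Ici (c : σ →₀ ℕ) :
    HasDenominator (coneDenominator d) (weightSeries d (Set.Ici c)) := by
  have e : Set.Ici c = (fun a => c + a) '' Set.univ := by
    ext a
    simp only [Set.mem_Ici, Set.image_univ, Set.mem_range]
    exact le_iff_exists_add.trans (exists_congr fun _ => eq_comm)
  rw [e, weightSeries_image (τ := d) (add_right_injective _).injOn (map_add d _)]
  exact (hasDenominator_univ hd).monomial_mul _

/-- Inclusion–exclusion: the cone at `c` meets the cone at `b` in the cone at `c ⊔ b`. The overlap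
is thus again a union of `l.length` cones, so induction on the length, for all lists at once,
suffices. -/
theorem hasDenominator_biUnion_Ici (l : List (σ →₀ ℕ)) :
    HasDenominator (coneDenominator d) (weightSeries d {a | ∃ c ∈ l, c ≤ a}) := by
  obtain ⟨n, hn⟩ : ∃ n, l.length = n := ⟨_, rfl⟩
  induction n generalizing l with
  | zero =>
    rw [List.length_eq_zero_iff] at hn
    simpa [hn, weightSeries_empty] using HasDenominator.zero
  | succ n ih =>
    obtain ⟨c, l, rfl⟩ := List.exists_cons_of_length_eq_add_one hn
    have hl : l.length = n := by simpa using hn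
    have h := weightSeries_union_add_inter (finite_fiber_of_ne_zero d hd) (Set.Ici c)
      {a | ∃ b ∈ l, b ≤ a}
    have e1 : Set.Ici c ∪ {a | ∃ b ∈ l, b ≤ a} = {a | ∃ b ∈ c :: l, b ≤ a} := by
      ext a
      simp
    have e2 : Set.Ici c ∩ {a | ∃ b ∈ l, b ≤ a} = {a | ∃ b ∈ l.map (c ⊔ ·), b ≤ a} := by
      ext a
      simp only [Set.mem_inter_iff, Set.mem_Ici, Set.mem_ofPred_eq, List.mem_map,
        exists_exists_and_eq_and, sup_le_iff]
      tauto
    rw [e1, e2] at h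
    rw [eq_sub_of_add_eq h]
    exact ((hasDenominator_Ici hd c).add (ih l hl)).sub (ih _ (by simpa using hl))

/-- Dickson's lemma: the minimal elements form an antichain in a well-quasi-order, hence a finite
set, and their cones cover `U`. -/
theorem hasDenominator_of_isUpperSet {U : Set (σ →₀ ℕ)} (hU : IsUpperSet U) :
    HasDenominator (coneDenominator d) (weightSeries d U) := by
  have hfin : {a | Minimal (· ∈ U) a}.Finite :=
    WellQuasiOrderedLE.finite_of_isAntichain (setOfPred_minimal_antichain _)
  have e : U = {a | ∃ c ∈ hfin.toFinset.toList, c ≤ a} := by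
    ext a
    simp only [Finset.mem_toList, Set.Finite.mem_toFinset, Set.mem_ofPred_eq]
    constructor
    · intro ha
      obtain ⟨b, hb, hm⟩ := exists_minimal_le_of_wellFoundedLT (· ∈ U) a ha
      exact ⟨b, hm, hb⟩
    · rintro ⟨c, hc, hca⟩
      exact hU hca hc.prop
  rw [e]
  exact hasDenominator_biUnion_Ici hd _

end Cones

/-! ### Graded ℕ^σ-sets -/

section Action

variable {σ ι X : Type*} [Fintype σ] [AddAction (σ →₀ ℕ) X] {d : (σ →₀ ℕ) →+ (ι →₀ ℕ)}
  {τ : X → ι →₀ ℕ}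

/-- Each point of the orbit is represented by its least exponent in a monomial order. Translation
invariance of the order makes the non-least exponents `N` an upper set, and `B \ N` maps bijectively
onto `V`. -/
theorem hasDenominator_of_subset_orbit (hd : ∀ j, d (Finsupp.single j 1) ≠ 0)
    (hτ : ∀ a x, τ (a +ᵥ x) = d a + τ x) {V : Set X}
    (hV : ∀ (a : σ →₀ ℕ), ∀ x ∈ V, a +ᵥ x ∈ V) (w : X) (hw : V ⊆ AddAction.orbit (σ →₀ ℕ) w) :
    HasDenominator (coneDenominator d) (weightSeries τ V) := by
  classical
  let _ : LinearOrder σ := linearOrderOfSTO WellOrderingRel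
  let m : MonomialOrder σ := MonomialOrder.lex
  let B : Set (σ →₀ ℕ) := {a | a +ᵥ w ∈ V}
  let N : Set (σ →₀ ℕ) := {a | ∃ b, m.toSyn b < m.toSyn a ∧ b +ᵥ w = a +ᵥ w}
  have hB : IsUpperSet B := by
    intro a b hab ha
    obtain ⟨c, rfl⟩ := exists_add_of_le hab
    change _ +ᵥ w ∈ V
    rw [add_comm, add_vadd]
    exact hV _ _ ha
  have hN : IsUpperSet N := by
    rintro a b hab ⟨a', h1, h2⟩
    obtain ⟨c, rfl⟩ := exists_add_of_le hab
    refine ⟨c + a', ?_, by rw [add_comm a c, add_vadd, add_vadd, h2]⟩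
    rw [map_add, map_add, add_comm]
    exact lt_of_le_of_ne (by gcongr) fun h => h1.ne (by simpa using h)
  have e : V = (fun a => a +ᵥ w) '' (B \ N) := by
    ext x
    constructor
    · intro hx
      have hne : {a : σ →₀ ℕ | a +ᵥ w = x}.Nonempty := hw hx
      obtain ⟨a, ha, hmin⟩ := (InvImage.wf m.toSyn wellFounded_lt).has_min _ hne
      have ha : a +ᵥ w = x := ha
      refine ⟨a, ⟨?_, ?_⟩, ha⟩
      · change a +ᵥ w ∈ V
        rwa [ha]
      · rintro ⟨b, hb, hab⟩
        exact hmin b (hab.trans ha) hb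
    · rintro ⟨a, ⟨ha, -⟩, rfl⟩
      exact ha
  have hinj : Set.InjOn (fun a : σ →₀ ℕ => a +ᵥ w) (B \ N) := by
    rintro a ⟨-, ha⟩ b ⟨-, hb⟩ hab
    rcases lt_trichotomy (m.toSyn a) (m.toSyn b) with h | h | h
    · exact (hb ⟨a, h, hab⟩).elim
    · exact m.toSyn.injective h
    · exact (ha ⟨b, h, hab.symm⟩).elim
  rw [e, weightSeries_image hinj (τ := d) (c := τ w) (fun a => by rw [hτ, add_comm]),
    weightSeries_sdiff (finite_fiber_of_ne_zero d hd)]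
  exact ((hasDenominator_of_isUpperSet hd hB).sub
    (hasDenominator_of_isUpperSet hd (hB.inter hN))).monomial_mul _

/-- A combinatorial form of the Hilbert–Serre theorem: the generating series of a stable subset
of a finitely generated graded `ℕ^σ`-set is rational. -/
theorem hasDenominator_of_subset_orbits (hd : ∀ j, d (Finsupp.single j 1) ≠ 0)
    (hτ : ∀ a x, τ (a +ᵥ x) = d a + τ x) (hfin : ∀ k, (τ ⁻¹' {k}).Finite)
    {F : Set X} (hF : F.Finite) {V : Set X}
    (hV : ∀ (a : σ →₀ ℕ), ∀ x ∈ V, a +ᵥ x ∈ V) (hVF : ∀ x ∈ V, ∃ w ∈ F, ∃ a : σ →₀ ℕ, a +ᵥ w = x) :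
    HasDenominator (coneDenominator d) (weightSeries τ V) := by
  induction F, hF using Set.Finite.induction_on generalizing V with
  | empty =>
    have e : V = ∅ := Set.eq_empty_of_forall_notMem fun x hx => by simpa using hVF x hx
    rw [e, weightSeries_empty]
    exact HasDenominator.zero
  | @insert w F _ _ ih =>
    let Y : Set X := {x ∈ V | ∃ a : σ →₀ ℕ, a +ᵥ w = x}
    let Z : Set X := {x ∈ V | ∃ v ∈ F, ∃ a : σ →₀ ℕ, a +ᵥ v = x}
    have hY : ∀ (a : σ →₀ ℕ), ∀ x ∈ Y, a +ᵥ x ∈ Y := by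
      rintro a x ⟨hx, b, rfl⟩
      exact ⟨hV _ _ hx, a + b, add_vadd _ _ _⟩
    have hZ : ∀ (a : σ →₀ ℕ), ∀ x ∈ Z, a +ᵥ x ∈ Z := by
      rintro a x ⟨hx, v, hv, b, rfl⟩
      exact ⟨hV _ _ hx, v, hv, a + b, add_vadd _ _ _⟩
    have e : Y ∪ Z = V := by
      refine Set.Subset.antisymm (Set.union_subset (fun x hx => hx.1) fun x hx => hx.1) ?_
      intro x hx
      obtain ⟨v, rfl | hv, h⟩ := hVF x hx
      · exact Or.inl ⟨hx, h⟩
      · exact Or.inr ⟨hx, v, hv, h⟩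
    -- The overlap `Y ∩ Z` is stable and lies in the orbit of `w`, so the one-orbit case covers it
    -- too.
    rw [← e, eq_sub_of_add_eq (weightSeries_union_add_inter hfin Y Z)]
    exact ((hasDenominator_of_subset_orbit hd hτ hY w fun x hx => hx.2).add
      (ih hZ fun x hx => hx.2)).sub (hasDenominator_of_subset_orbit hd hτ
        (fun a x hx => ⟨hY a x hx.1, hZ a x hx.2⟩) w fun x hx => hx.1.2)

end Action

/-! ### Central powers in the factorization semigroup -/

namespace Factorization

section

variable {G : Type*} [Group G] (O : Set G)

theorem factorSubgroup_mul (s t : FactSemigroup O) :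
    factorSubgroup O (s * t) = factorSubgroup O s ⊔ factorSubgroup O t := by
  obtain ⟨v, rfl⟩ := PresentedMonoid.surjective_mk s
  obtain ⟨w, rfl⟩ := PresentedMonoid.surjective_mk t
  rw [← map_mul]
  exact wordSubgroup_mul O v w

variable {O}

theorem of_mul_of_right {a b c : O} (h : (c : G) = (b : G)⁻¹ * a * b) :
    PresentedMonoid.of (Rel O) a * PresentedMonoid.of (Rel O) b =
      PresentedMonoid.of (Rel O) b * PresentedMonoid.of (Rel O) c :=
  PresentedMonoid.mk_eq_mk_of_rel (Rel.right a b c h)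

theorem of_mul_of_left {a b c : O} (h : (c : G) = (a : G) * b * (a : G)⁻¹) :
    PresentedMonoid.of (Rel O) a * PresentedMonoid.of (Rel O) b =
      PresentedMonoid.of (Rel O) c * PresentedMonoid.of (Rel O) a :=
  PresentedMonoid.mk_eq_mk_of_rel (Rel.left a b c h)

/-- The element of the factorization semigroup given by a list of letters. -/
abbrev ofList (l : List O) : FactSemigroup O := PresentedMonoid.mk (Rel O) (FreeMonoid.ofList l)

theorem ofList_append (l l' : List O) : ofList (l ++ l') = ofList l * ofList l' := rfl

theorem ofList_cons (a : O) (l : List O) :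
    ofList (a :: l) = PresentedMonoid.of (Rel O) a * ofList l := rfl

theorem ofList_nil : ofList ([] : List O) = 1 := rfl

variable (hO : ∀ g : G, ∀ x ∈ O, g * x * g⁻¹ ∈ O)

include hO

theorem pow_mul_of (a b : O) (k : ℕ) :
    PresentedMonoid.of (Rel O) a ^ k * PresentedMonoid.of (Rel O) b =
      PresentedMonoid.of (Rel O) ⟨(a : G) ^ k * b * ((a : G) ^ k)⁻¹, hO _ _ b.2⟩ *
        PresentedMonoid.of (Rel O) a ^ k := by
  induction k with
  | zero => simp
  | succ k ih =>
    rw [pow_succ', mul_assoc, ih, ← mul_assoc, ← mul_assoc,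
      of_mul_of_left (c := ⟨(a : G) ^ (k + 1) * b * ((a : G) ^ (k + 1))⁻¹, hO _ _ b.2⟩)]
    simp only [pow_succ']
    group

theorem of_pow_mem_center (a : O) {n : ℕ} (hn : (a : G) ^ n = 1) :
    PresentedMonoid.of (Rel O) a ^ n ∈ Submonoid.center (FactSemigroup O) := by
  rw [Submonoid.mem_center_iff]
  intro s
  obtain ⟨w, rfl⟩ := PresentedMonoid.surjective_mk s
  induction w using FreeMonoid.inductionOn' with
  | one => simp
  | of_mul b w ih =>
    have h := pow_mul_of hO a b n
    simp only [hn, one_mul, inv_one, mul_one, Subtype.coe_eta] at h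
    change PresentedMonoid.of (Rel O) b * PresentedMonoid.mk (Rel O) w * _ =
      _ * (PresentedMonoid.of (Rel O) b * PresentedMonoid.mk (Rel O) w)
    rw [mul_assoc, ih, ← mul_assoc, ← mul_assoc, h]

/-- Moving `b` to the left conjugates each letter it passes and preserves their number. -/
theorem exists_ofList_mul_of (b : O) (l : List O) :
    ∃ l' : List O, l'.length = l.length ∧
      ofList l * PresentedMonoid.of (Rel O) b = PresentedMonoid.of (Rel O) b * ofList l' := by
  induction l with
  | nil => exact ⟨[], rfl, by rw [ofList_nil, one_mul, mul_one]⟩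
  | cons a l ih =>
    obtain ⟨l', h1, h2⟩ := ih
    let c : O := ⟨(b : G)⁻¹ * a * b, by simpa using hO (b : G)⁻¹ a a.2⟩
    refine ⟨c :: l', by simp [h1], ?_⟩
    rw [ofList_cons, ofList_cons, mul_assoc, h2, ← mul_assoc, ← mul_assoc,
      of_mul_of_right (c := c) rfl]

theorem exists_ofList_eq_pow_mul [DecidableEq O] (b : O) (n : ℕ) (l : List O)
    (hn : n ≤ l.count b) : ∃ l' : List O, l'.length + n = l.length ∧
      ofList l = PresentedMonoid.of (Rel O) b ^ n * ofList l' := by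
  induction n generalizing l with
  | zero => exact ⟨l, rfl, by simp⟩
  | succ n ih =>
    have hb : b ∈ l := List.count_pos_iff.1 (by lia)
    -- Splitting at the first occurrence keeps all other copies of `b` in `l₂`, which the move
    -- leaves untouched.
    obtain ⟨l₁, l₂, rfl, h₁⟩ := List.eq_append_cons_of_mem hb
    obtain ⟨l₁', h2, h3⟩ := exists_ofList_mul_of hO b l₁
    have hc : n ≤ (l₁' ++ l₂).count b := by
      rw [List.count_append, List.count_eq_zero_of_not_mem h₁, List.count_cons_self] at hn
      rw [List.count_append]
      lia
    obtain ⟨l', h4, h5⟩ := ih _ hc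
    refine ⟨l', by simp at h4 ⊢; lia, ?_⟩
    rw [ofList_append, ofList_cons, ← mul_assoc, h3, mul_assoc, ← ofList_append, h5, pow_succ',
      mul_assoc]

end

theorem exists_le_count {α : Type*} [Fintype α] [DecidableEq α] (n : ℕ) (l : List α)
    (h : Fintype.card α * n < l.length) : ∃ a, n ≤ l.count a := by
  by_contra! hc
  have h1 : ∑ a, l.count a = l.length := by
    simpa using Multiset.sum_count_eq_card (s := Finset.univ) (m := (l : Multiset α)) (by simp)
  have h2 : ∑ a, l.count a ≤ ∑ _a : α, n := Finset.sum_le_sum fun a _ => (hc a).le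
  simp at h2
  lia

/-! ### The action of ℕ^O and its finite generation -/

section

variable {G : Type*} [Group G] {m : ℕ} (C : Fin m → ConjClasses G)

theorem conj_mem_classUnion (g x : G) (hx : x ∈ classUnion C) :
    g * x * g⁻¹ ∈ classUnion C := by
  obtain ⟨i, hi⟩ := Set.mem_iUnion.1 hx
  refine Set.mem_iUnion.2 ⟨i, ?_⟩
  rw [ConjClasses.mem_carrier_iff_mk_eq] at hi ⊢
  rw [← hi]
  exact (ConjClasses.mk_eq_mk_iff_isConj.2 (isConj_iff.2 ⟨g, rfl⟩)).symm

theorem typeVector_one : typeVector C 1 = 0 := by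
  ext i
  simp [typeVector]

theorem typeVector_mul (s t : FactSemigroup (classUnion C)) :
    typeVector C (s * t) = typeVector C s + typeVector C t := by
  ext i
  simp [typeVector]

theorem typeVector_pow (s : FactSemigroup (classUnion C)) (n : ℕ) :
    typeVector C (s ^ n) = n • typeVector C s := by
  ext i
  simp [typeVector]

theorem typeVector_of_ne_zero (a : classUnion C) :
    typeVector C (PresentedMonoid.of (Rel (classUnion C)) a) ≠ 0 := by
  obtain ⟨j, hj⟩ := Set.mem_iUnion.1 a.2
  intro h
  have h' := DFunLike.congr_fun h j
  simp [typeVector, classCount, classIndicator, hj] at h'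

theorem finite_typeVector_fiber [Finite G] (k : Fin m →₀ ℕ) : (typeVector C ⁻¹' {k}).Finite := by
  refine ((List.finite_length_le (classUnion C) (∑ i, k i)).image ofList).subset ?_
  rintro s rfl
  obtain ⟨w, rfl⟩ := PresentedMonoid.surjective_mk s
  exact ⟨FreeMonoid.toList w, length_le_sum_classCount C w, rfl⟩

/-- The central element `x_a ^ |G|`. -/
noncomputable def centralPow (a : classUnion C) : Submonoid.center (FactSemigroup (classUnion C)) :=
  ⟨_, of_pow_mem_center (conj_mem_classUnion C) a (pow_card_eq_one' (G := G))⟩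

/-- The products of the central elements `x_a ^ |G|`. -/
noncomputable def centralProd : Multiplicative (classUnion C →₀ ℕ) →*
    Submonoid.center (FactSemigroup (classUnion C)) where
  toFun a := a.toAdd.prod fun g k => centralPow C g ^ k
  map_one' := by simp
  map_mul' a b := Finsupp.prod_add_index' (by simp) (fun _ _ _ => pow_add _ _ _)

theorem centralProd_single (a : classUnion C) :
    (centralProd C (Multiplicative.ofAdd (Finsupp.single a 1)) : FactSemigroup (classUnion C)) =
      PresentedMonoid.of (Rel (classUnion C)) a ^ Nat.card G := by
  change ((Finsupp.single a 1).prod fun g k => centralPow C g ^ k :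
    Submonoid.center (FactSemigroup (classUnion C))).1 = _
  simp [centralPow]

/-- The action of `ℕ^O` on the factorization semigroup through the central elements
`x_a ^ |G|`. -/
noncomputable abbrev centralAction : AddAction (classUnion C →₀ ℕ) (FactSemigroup (classUnion C)) where
  vadd a s := (centralProd C (Multiplicative.ofAdd a) : FactSemigroup (classUnion C)) * s
  zero_vadd s := by
    change ((centralProd C 1 : Submonoid.center _) : FactSemigroup (classUnion C)) * s = s
    simp
  add_vadd a b s := by
    change ((centralProd C (Multiplicative.ofAdd (a + b)) : Submonoid.center _) :
      FactSemigroup (classUnion C)) * s = _ * (_ * s)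
    rw [ofAdd_add, map_mul, Submonoid.coe_mul, mul_assoc]

/-- The type of the product of the central elements `x_a ^ |G|`. -/
noncomputable def centralWeight : (classUnion C →₀ ℕ) →+ (Fin m →₀ ℕ) where
  toFun a := typeVector C (centralProd C (Multiplicative.ofAdd a))
  map_zero' := by
    rw [ofAdd_zero, map_one, Submonoid.coe_one, typeVector_one]
  map_add' a b := by
    rw [ofAdd_add, map_mul, Submonoid.coe_mul, typeVector_mul]

theorem prodHom_centralProd (a : Multiplicative (classUnion C →₀ ℕ)) :
    prodHom (classUnion C) (centralProd C a) = 1 := by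
  have h : ((prodHom (classUnion C)).comp (Submonoid.subtype _)).comp (centralProd C) = 1 := by
    refine Finsupp.mulHom_ext fun b k => ?_
    have e : Multiplicative.ofAdd (Finsupp.single b k) =
        Multiplicative.ofAdd (Finsupp.single b 1) ^ k := by
      rw [← ofAdd_nsmul, Finsupp.smul_single_one]
    have e' : prodHom (classUnion C) (PresentedMonoid.of (Rel (classUnion C)) b) = b := rfl
    rw [e, map_pow, map_pow, MonoidHom.comp_apply, MonoidHom.comp_apply, Submonoid.subtype_apply,
      centralProd_single, map_pow, e', pow_card_eq_one', one_pow]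
    exact (one_pow k).symm
  exact DFunLike.congr_fun h a

variable [Finite G]

theorem centralWeight_single_ne_zero (a : classUnion C) :
    centralWeight C (Finsupp.single a 1) ≠ 0 := by
  change typeVector C (centralProd C (Multiplicative.ofAdd (Finsupp.single a 1))) ≠ 0
  rw [centralProd_single, typeVector_pow]
  exact smul_ne_zero Nat.card_pos.ne' (typeVector_of_ne_zero C a)

/-- Pigeonhole and descent: splitting off some `x_b ^ |G|` shortens a long word by |G| > 0 letters.
-/
theorem exists_centralProd_mul_ofList (l : List (classUnion C)) :
    ∃ l' : List (classUnion C), l'.length ≤ Nat.card (classUnion C) * Nat.card G ∧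
      ∃ a, (centralProd C a : FactSemigroup (classUnion C)) * ofList l' = ofList l := by
  classical
  have := Fintype.ofFinite (classUnion C)
  obtain ⟨n, hn⟩ : ∃ n, l.length = n := ⟨_, rfl⟩
  induction n using Nat.strong_induction_on generalizing l with
  | _ n ih =>
    by_cases hl : l.length ≤ Nat.card (classUnion C) * Nat.card G
    · exact ⟨l, hl, 1, by simp⟩
    · rw [not_le, Nat.card_eq_fintype_card] at hl
      obtain ⟨b, hb⟩ := exists_le_count _ l hl
      obtain ⟨l₁, h1, h2⟩ := exists_ofList_eq_pow_mul (conj_mem_classUnion C) b _ l hb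
      have hpos : 0 < Nat.card G := Nat.card_pos
      obtain ⟨l', h3, a, h4⟩ := ih l₁.length (by lia) l₁ rfl
      refine ⟨l', h3, Multiplicative.ofAdd (Finsupp.single b 1) * a, ?_⟩
      rw [map_mul, Submonoid.coe_mul, centralProd_single, mul_assoc, h4, h2]

theorem hasDenominator_genFun [Fintype (classUnion C)] :
    HasDenominator (coneDenominator (centralWeight C)) (genFun C) := by
  let _ := centralAction C
  -- `genFun C` is definitionally the weight series of S(G, O)^G_1.
  refine hasDenominator_of_subset_orbits (τ := typeVector C) (V := factSet (classUnion C) ⊤ ⊥)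
    (F := ofList '' {l | l.length ≤ Nat.card (classUnion C) * Nat.card G})
    (centralWeight_single_ne_zero C) (fun a s => typeVector_mul C _ s) (finite_typeVector_fiber C)
    ((List.finite_length_le _ _).image _) ?_ ?_
  -- Stability: extra factors cannot enlarge a subgroup that is already `⊤`, and central products
  -- have image 1 in G.
  · rintro a s ⟨h1, h2⟩
    refine ⟨(factorSubgroup_mul _ _ s).trans (by rw [h1, sup_top_eq]), ?_⟩
    change prodHom (classUnion C) (_ * s) ∈ _
    rwa [map_mul, prodHom_centralProd, one_mul]
  · intro s _
    obtain ⟨w, rfl⟩ := PresentedMonoid.surjective_mk s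
    obtain ⟨l', h, a, h'⟩ := exists_centralProd_mul_ofList C (FreeMonoid.toList w)
    exact ⟨_, ⟨l', h, rfl⟩, a.toAdd, h'⟩

end

end Factorization

theorem mainTheorem8 {G : Type*} [Group G] [Finite G] {m : ℕ}
    (C : Fin m → ConjClasses G) (hC : Function.Injective C)
    (hgen : ∀ i, Subgroup.closure (C i).carrier = ⊤) :
    Factorization.IsRationalFunction (Factorization.genFun C) := by
  have := Fintype.ofFinite (Factorization.classUnion C)
  obtain ⟨P, hP⟩ := Factorization.hasDenominator_genFun C
  exact ⟨P, _, coeff_zero_coneDenominator (Factorization.centralWeight_single_ne_zero C), hP⟩
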